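/- Let $\mathbb{C}$ be a regular category (finitely complete, kernel pairs have coequalisers, and regular epimorphisms are stable under pullback). A relation on $X$ is a subobject of $X\times X$, relations are composed by taking images of pullbacks, and $\mathbb{C}$ is called a Goursat category if $RSR=SRS$ for all equivalence relations $R,S$ on the same object of $\mathbb{C}$. Let $\mathrm{RG}(\mathbb{C})$ be the category of reflexive graphs $d,c\colon X_1\rightrightarrows X_0$, $e\colon X_0\to X_1$, $de=1_{X_0}=ce$, in $\mathbb{C}$, with the evident morphisms. An internal category structure on such a graph is a morphism $m\colon X_1\times_{X_0}X_1\to X_1$, where $X_1\times_{X_0}X_1$ is the pullback with projections $p_1,p_2$ and $c\,p_1=d\,p_2$, satisfying $d\,m=d\,p_1$, $c\,m=c\,p_2$, $m\langle ed,1\rangle=1=m\langle 1,ec\rangle$ and $m(1\times m)=m(m\times 1)$. It is a groupoid structure if there is moreover $i\colon X_1\to X_1$ with $d\,i=c$, $c\,i=d$, $m\langle i,1\rangle=ec$ and $m\langle 1,i\rangle=ed$. The reflexive graphs admitting an internal category structure, respectively an internal groupoid structure, are said to belong to $\mathrm{Cat}(\mathbb{C})$, respectively $\mathrm{Grpd}(\mathbb{C})$.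 A class $\mathbb{P}$ of objects of a category $\mathbb{Q}$ is closed under (regular) quotients in $\mathbb{Q}$ if, for every regular epimorphism $f\colon A\to B$ in $\mathbb{Q}$ with $A\in\mathbb{P}$, also $B\in\mathbb{P}$. Then the following conditions are equivalent: (i) $\mathbb{C}$ is a Goursat category; (ii) $\mathrm{Grpd}(\mathbb{C})$ is closed under regular quotients in $\mathrm{RG}(\mathbb{C})$; (iii) $\mathrm{Cat}(\mathbb{C})$ is closed under regular quotients in $\mathrm{RG}(\mathbb{C})$. -/

import Mathlib

open CategoryTheory CategoryTheory.Limits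

universe v u

noncomputable section

namespace Goursat

section Relations

variable {C : Type u} [Category.{v} C] [Regular C]

/-- A relation from `X` to `Y`: a subobject of `X ⨯ Y`. -/
abbrev Relation (X Y : C) := Subobject (X ⨯ Y)

/-- The first leg `R ⟶ X` of a relation `R` from `X` to `Y`. -/
abbrev Relation.left {X Y : C} (R : Relation X Y) : (R : C) ⟶ X :=
  Subobject.arrow R ≫ prod.fst

/-- The second leg `R ⟶ Y` of a relation `R` from `X` to `Y`. -/
abbrev Relation.right {X Y : C} (R : Relation X Y) : (R : C) ⟶ Y :=
  Subobject.arrow R ≫ prod.snd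

/-- The composite `SR` of a relation `R` from `X` to `Y` and a relation `S` from `Y` to `Z`
(first `R`, then `S`): the image of the arrow `R ×_Y S ⟶ X ⨯ Z`. -/
def Relation.comp {X Y Z : C} (S : Relation Y Z) (R : Relation X Y) : Relation X Z :=
  imageSubobject (prod.lift
    (pullback.fst (Relation.right R) (Relation.left S) ≫ Relation.left R)
    (pullback.snd (Relation.right R) (Relation.left S) ≫ Relation.right S))

/-- An equivalence relation on `X`: a reflexive, symmetric and transitive relation on `X`. -/
def Relation.IsEquiv {X : C} (R : Relation X X) : Prop :=
  IsEquivalenceRelation (Relation.left R) (Relation.right R)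

end Relations

/-- A regular category is Goursat when its equivalence relations are 3-permutable:
`RSR = SRS` for all equivalence relations `R`, `S` on the same object. -/
def IsGoursat (C : Type u) [Category.{v} C] [Regular C] : Prop :=
  ∀ (X : C) (R S : Relation X X), Relation.IsEquiv R → Relation.IsEquiv S →
    Relation.comp (Relation.comp R S) R = Relation.comp (Relation.comp S R) S

/-- A reflexive graph in `C`: `d, c : X₁ ⟶ X₀` with a common section `e`. -/
structure ReflexiveGraph (C : Type u) [Category.{v} C] where
  X₀ : C
  X₁ : C
  d : X₁ ⟶ X₀
  c : X₁ ⟶ X₀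
  e : X₀ ⟶ X₁
  e_d : e ≫ d = 𝟙 X₀
  e_c : e ≫ c = 𝟙 X₀

namespace ReflexiveGraph

attribute [simp] e_d e_c

variable {C : Type u} [Category.{v} C]

/-- A morphism of reflexive graphs. -/
@[ext]
structure Hom (G H : ReflexiveGraph C) where
  f₀ : G.X₀ ⟶ H.X₀
  f₁ : G.X₁ ⟶ H.X₁
  comm_d : f₁ ≫ H.d = G.d ≫ f₀
  comm_c : f₁ ≫ H.c = G.c ≫ f₀
  comm_e : G.e ≫ f₁ = f₀ ≫ H.e

/-- The category `RG(C)` of reflexive graphs in `C`. -/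
instance : Category.{v} (ReflexiveGraph C) where
  Hom := Hom
  id G := ⟨𝟙 _, 𝟙 _, by simp, by simp, by simp⟩
  comp {G H K} a b :=
    ⟨a.f₀ ≫ b.f₀, a.f₁ ≫ b.f₁,
      by rw [Category.assoc, b.comm_d, ← Category.assoc, a.comm_d, Category.assoc],
      by rw [Category.assoc, b.comm_c, ← Category.assoc, a.comm_c, Category.assoc],
      by rw [← Category.assoc, a.comm_e, Category.assoc, b.comm_e, Category.assoc]⟩
  id_comp _ := Hom.ext (Category.id_comp _) (Category.id_comp _)
  comp_id _ := Hom.ext (Category.comp_id _) (Category.comp_id _)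
  assoc _ _ _ := Hom.ext (Category.assoc _ _ _) (Category.assoc _ _ _)

end ReflexiveGraph

section Internal

variable {C : Type u} [Category.{v} C] [HasPullbacks C]

/-- The object `X₁ ×_{X₀} X₁` of composable pairs `(x, y)`, `c x = d y`. -/
abbrev ReflexiveGraph.pairs (G : ReflexiveGraph C) : C := pullback G.c G.d

/-- The object `X₁ ×_{X₀} X₁ ×_{X₀} X₁` of composable triples `(x, y, z)`, as the pullback of
`(x, y) ↦ y` and `(y, z) ↦ y`. -/
abbrev ReflexiveGraph.triples (G : ReflexiveGraph C) : C :=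
  pullback (pullback.snd G.c G.d) (pullback.fst G.c G.d)

/-- The structure of an internal category on a reflexive graph; `m (x, y)` is the composite
"first `x`, then `y`". -/
structure InternalCategory (G : ReflexiveGraph C) where
  m : G.pairs ⟶ G.X₁
  m_d : m ≫ G.d = pullback.fst G.c G.d ≫ G.d
  m_c : m ≫ G.c = pullback.snd G.c G.d ≫ G.c
  id_m : pullback.lift (G.d ≫ G.e) (𝟙 G.X₁) (by simp) ≫ m = 𝟙 G.X₁
  m_id : pullback.lift (𝟙 G.X₁) (G.c ≫ G.e) (by simp) ≫ m = 𝟙 G.X₁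
  /-- `m ∘ (1 × m) = m ∘ (m × 1)` on composable triples. -/
  assoc :
    pullback.lift
        (pullback.fst (pullback.snd G.c G.d) (pullback.fst G.c G.d) ≫ pullback.fst G.c G.d)
        (pullback.snd (pullback.snd G.c G.d) (pullback.fst G.c G.d) ≫ m)
        (by rw [Category.assoc, Category.assoc, m_d, pullback.condition,
              pullback.condition_assoc]) ≫ m =
      pullback.lift
        (pullback.fst (pullback.snd G.c G.d) (pullback.fst G.c G.d) ≫ m)
        (pullback.snd (pullback.snd G.c G.d) (pullback.fst G.c G.d) ≫ pullback.snd G.c G.d)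
        (by rw [Category.assoc, Category.assoc, m_c, ← pullback.condition,
              pullback.condition_assoc]) ≫ m

/-- The structure of an internal groupoid on a reflexive graph: an internal category with
inverses. -/
structure InternalGroupoid (G : ReflexiveGraph C) extends InternalCategory G where
  i : G.X₁ ⟶ G.X₁
  i_d : i ≫ G.d = G.c
  i_c : i ≫ G.c = G.d
  i_m : pullback.lift i (𝟙 G.X₁) (by rw [i_c, Category.id_comp]) ≫ m = G.c ≫ G.e
  m_i : pullback.lift (𝟙 G.X₁) i (by rw [i_d, Category.id_comp]) ≫ m = G.d ≫ G.e

variable (C)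

/-- The reflexive graphs in `C` that belong to `Cat(C)`. -/
def isCat : ObjectProperty (ReflexiveGraph C) := fun G => Nonempty (InternalCategory G)

/-- The reflexive graphs in `C` that belong to `Grpd(C)`. -/
def isGrpd : ObjectProperty (ReflexiveGraph C) := fun G => Nonempty (InternalGroupoid G)

end Internal

/-- A class `P` of objects of `D` is closed under (regular) quotients in `D` when, for every
regular epimorphism `f : A ⟶ B` in `D` with `A` in `P`, also `B` is in `P`. -/
def ClosedUnderRegularQuotients {D : Type u} [Category.{v} D] (P : ObjectProperty D) : Prop :=
  ∀ ⦃A B : D⦄ (f : A ⟶ B), IsRegularEpi f → P A → P B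

end Goursat

end

/-! The argument is set-like: morphisms `T ⟶ X` are treated as elements of `X`, and existence is
understood locally, after a regular epimorphism onto `T`. Composites of relations then mean what
they mean for sets.

Suppose the category is Goursat. Permuting kernel pairs gives the Shifting Lemma
(`IsGoursat.shifting`). Applied to objects of composable pairs, it shows that composition in an
internal category, and inversion in a groupoid, respect the kernel pair of any graph morphism `f`.
For these operations to descend along a quotient `f`, composable pairs must also lift. Since `d` is
split by `e`, permutability moves two arrows with identified domains, without changing their images,
until the domains agree (`IsGoursat.exists_matching`); inversion turns composable pairs into pairs
with a common domain. Categories reduce to groupoids, because permutability on composable triples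
inverts every arrow (`exists_local_right_inverse`).

Conversely, both closure conditions imply that a quotient of a groupoid is a category. For
equivalence relations `R`, `S` on `X`, pull `S` back along one leg of `R` and take its image along
the other: the result is `RSR`, a quotient of a groupoid. It is thus a category, and for a relation
this means transitivity. Containing `R` and `S`, it contains `SRS`; exchanging `R` and `S` gives
equality. -/

noncomputable section

namespace Goursat

attribute [local simp] prod.lift_fst prod.lift_snd prod.lift_fst_assoc prod.lift_snd_assoc
  pullback.lift_fst pullback.lift_snd pullback.lift_fst_assoc pullback.lift_snd_assoc

/-! ### Descent and local lifting along regular epimorphisms -/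

section RegularEpi

variable {C : Type u} [Category.{v} C]

/-- A morphism descends along a regular epimorphism if it identifies the generalised elements that
the regular epimorphism identifies. -/
lemma exists_descent {X Y Z : C} (f : X ⟶ Y) [IsRegularEpi f] (k : X ⟶ Z)
    (h : ∀ ⦃T : C⦄ (x y : T ⟶ X), x ≫ f = y ≫ f → x ≫ k = y ≫ k) : ∃ g : Y ⟶ Z, f ≫ g = k :=
  ⟨IsRegularEpi.desc f k (h _ _ (IsRegularEpi.w f)), IsRegularEpi.fac f k _⟩

/-- Lifting through a monomorphism is a local property. -/
lemma exists_lift_of_local {X Y T T' : C} (i : X ⟶ Y) [Mono i] (p : T' ⟶ T) [IsRegularEpi p]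
    (y : T ⟶ Y) (x : T' ⟶ X) (h : x ≫ i = p ≫ y) : ∃ x' : T ⟶ X, x' ≫ i = y :=
  have sq : CommSq x p i y := ⟨h⟩
  ⟨sq.lift, sq.fac_right⟩

variable [Regular C]

/-- Regular epimorphisms coincide with strong ones in a regular category, and strong ones compose.
-/
lemma isRegularEpi_comp {X Y Z : C} (f : X ⟶ Y) (g : Y ⟶ Z) [IsRegularEpi f] [IsRegularEpi g] :
    IsRegularEpi (f ≫ g) :=
  have : StrongEpi (f ≫ g) := strongEpi_comp f g
  inferInstance

/-- A morphism through which some regular epimorphism factors is a regular epimorphism. -/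
lemma isRegularEpi_of_fac {X Y T : C} (f : X ⟶ Y) (p : T ⟶ Y) [hp : IsRegularEpi p] (t : T ⟶ X)
    (h : t ≫ f = p) : IsRegularEpi f := by
  subst h
  have : StrongEpi f := strongEpi_of_strongEpi t f
  infer_instance

/-- Generalised elements lift along a regular epimorphism, locally. -/
lemma exists_local_lift {X Y T : C} (f : X ⟶ Y) [IsRegularEpi f] (y : T ⟶ Y) :
    ∃ (T' : C) (p : T' ⟶ T) (_ : IsRegularEpi p) (x : T' ⟶ X), x ≫ f = p ≫ y :=
  ⟨_, pullback.snd f y, inferInstance, pullback.fst f y, pullback.condition⟩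

end RegularEpi

/-! ### Relations in terms of generalised elements -/

section Relations

variable {C : Type u} [Category.{v} C] [Regular C]

/-- Two generalised elements are related by `R` when the pair that they form lies in `R`. -/
def Relation.Rel {X Y T : C} (R : Relation X Y) (x : T ⟶ X) (y : T ⟶ Y) : Prop :=
  ∃ w : T ⟶ (R : C), w ≫ Relation.left R = x ∧ w ≫ Relation.right R = y

namespace Relation

variable {X Y Z T T' : C}

lemma Rel.precomp {R : Relation X Y} {x : T ⟶ X} {y : T ⟶ Y} (h : R.Rel x y) (t : T' ⟶ T) :
    R.Rel (t ≫ x) (t ≫ y) := by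
  obtain ⟨w, rfl, rfl⟩ := h
  exact ⟨t ≫ w, by simp, by simp⟩

lemma rel_left_right (R : Relation X Y) : R.Rel (Relation.left R) (Relation.right R) :=
  ⟨𝟙 _, by simp, by simp⟩

lemma hom_ext (R : Relation X Y) {w w' : T ⟶ (R : C)}
    (h₁ : w ≫ Relation.left R = w' ≫ Relation.left R)
    (h₂ : w ≫ Relation.right R = w' ≫ Relation.right R) : w = w' := by
  rw [← cancel_mono R.arrow]
  ext
  · simpa using h₁
  · simpa using h₂

lemma le_of_rel {R S : Relation X Y} (h : S.Rel (Relation.left R) (Relation.right R)) : R ≤ S := by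
  obtain ⟨w, h₁, h₂⟩ := h
  refine Subobject.le_of_comm w ?_
  ext
  · simpa using h₁
  · simpa using h₂

/-- Being related is a local property. -/
lemma rel_of_local {R : Relation X Y} (p : T' ⟶ T) [IsRegularEpi p] {x : T ⟶ X} {y : T ⟶ Y}
    (h : R.Rel (p ≫ x) (p ≫ y)) : R.Rel x y := by
  obtain ⟨w, h₁, h₂⟩ := h
  obtain ⟨x', hx'⟩ := exists_lift_of_local R.arrow p (prod.lift x y) w (by
    ext
    · simpa using h₁
    · simpa using h₂)
  exact ⟨x', by simp [reassoc_of% hx'], by simp [reassoc_of% hx']⟩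

lemma rel_mk_iff {I : C} (i : I ⟶ X ⨯ Y) [Mono i] {x : T ⟶ X} {y : T ⟶ Y} :
    Relation.Rel (Subobject.mk i) x y ↔ ∃ w : T ⟶ I, w ≫ i = prod.lift x y := by
  constructor
  · rintro ⟨w, rfl, rfl⟩
    refine ⟨w ≫ (Subobject.underlyingIso i).hom, ?_⟩
    ext <;> simp
  · rintro ⟨w, hw⟩
    exact ⟨w ≫ (Subobject.underlyingIso i).inv, by simp [reassoc_of% hw], by simp [reassoc_of% hw]⟩

/-- Two generalised elements are related by an image when they lift locally. -/
lemma rel_image_iff {D : C} (g : D ⟶ X ⨯ Y) {x : T ⟶ X} {y : T ⟶ Y} :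
    Relation.Rel (imageSubobject g) x y ↔
      ∃ (T' : C) (p : T' ⟶ T) (_ : IsRegularEpi p) (w : T' ⟶ D),
        w ≫ g = p ≫ prod.lift x y := by
  rw [imageSubobject, rel_mk_iff]
  constructor
  · rintro ⟨w, hw⟩
    obtain ⟨T', p, hp, t, ht⟩ := exists_local_lift (factorThruImage g) w
    refine ⟨T', p, hp, t, ?_⟩
    rw [← hw, ← reassoc_of% ht, image.fac]
  · rintro ⟨T', p, hp, w, hw⟩
    exact exists_lift_of_local (image.ι g) p _ (w ≫ factorThruImage g) (by simpa using hw)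

/-- The middle element exists only locally, because a composite is an image and elements lift to the
source of an image only after a regular epimorphism. -/
lemma rel_comp_iff {R : Relation X Y} {S : Relation Y Z} {x : T ⟶ X} {z : T ⟶ Z} :
    (Relation.comp S R).Rel x z ↔
      ∃ (T' : C) (p : T' ⟶ T) (_ : IsRegularEpi p) (y : T' ⟶ Y),
        R.Rel (p ≫ x) y ∧ S.Rel y (p ≫ z) := by
  rw [Relation.comp, rel_image_iff]
  constructor
  · rintro ⟨T', p, hp, w, hw⟩
    have h₁ := congr($hw ≫ prod.fst)
    have h₂ := congr($hw ≫ prod.snd)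
    simp only [Category.assoc, prod.lift_fst, prod.lift_snd] at h₁ h₂
    refine ⟨T', p, hp, w ≫ pullback.fst _ _ ≫ Relation.right R,
      ⟨w ≫ pullback.fst _ _, by simpa using h₁, by simp⟩,
      ⟨w ≫ pullback.snd _ _, ?_, by simpa using h₂⟩⟩
    rw [pullback.condition, Category.assoc]
  · rintro ⟨T', p, hp, y, ⟨w, hw₁, hw₂⟩, ⟨w', hw'₁, hw'₂⟩⟩
    refine ⟨T', p, hp, pullback.lift w w' (hw₂.trans hw'₁.symm), ?_⟩
    ext
    · simpa using hw₁
    · simpa using hw'₂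

lemma rel_comp {R : Relation X Y} {S : Relation Y Z} {x : T ⟶ X} {y : T ⟶ Y} {z : T ⟶ Z}
    (h₁ : R.Rel x y) (h₂ : S.Rel y z) : (Relation.comp S R).Rel x z :=
  rel_comp_iff.2 ⟨T, 𝟙 T, inferInstance, y, by simpa using h₁, by simpa using h₂⟩

lemma rel_comp_comp {W : C} {R : Relation X Y} {S : Relation Y Z} {Q : Relation Z W}
    {x : T ⟶ X} {y : T ⟶ Y} {z : T ⟶ Z} {w : T ⟶ W}
    (h₁ : R.Rel x y) (h₂ : S.Rel y z) (h₃ : Q.Rel z w) :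
    (Relation.comp (Relation.comp Q S) R).Rel x w :=
  rel_comp h₁ (rel_comp h₂ h₃)

lemma exists_of_rel_comp_comp {W : C} {R : Relation X Y} {S : Relation Y Z} {Q : Relation Z W}
    {x : T ⟶ X} {w : T ⟶ W} (h : (Relation.comp (Relation.comp Q S) R).Rel x w) :
    ∃ (T' : C) (p : T' ⟶ T) (_ : IsRegularEpi p) (y : T' ⟶ Y) (z : T' ⟶ Z),
      R.Rel (p ≫ x) y ∧ S.Rel y z ∧ Q.Rel z (p ≫ w) := by
  obtain ⟨T₁, p, hp, y, hy, h'⟩ := rel_comp_iff.1 h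
  obtain ⟨T₂, q, hq, z, hz, hz'⟩ := rel_comp_iff.1 h'
  exact ⟨T₂, q ≫ p, isRegularEpi_comp q p, q ≫ y, z, by simpa using hy.precomp q, hz,
    by simpa using hz'⟩

section IsEquiv

variable {R : Relation X X}

lemma IsEquiv.refl (hR : R.IsEquiv) (x : T ⟶ X) : R.Rel x x := by
  obtain ⟨⟨e⟩⟩ := hR
  exact ⟨x ≫ e.r, by simp only [Category.assoc, e.reflexivity₁, Category.comp_id],
    by simp only [Category.assoc, e.reflexivity₂, Category.comp_id]⟩

lemma IsEquiv.symm (hR : R.IsEquiv) {x y : T ⟶ X} (h : R.Rel x y) : R.Rel y x := by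
  obtain ⟨⟨e⟩⟩ := hR
  obtain ⟨w, rfl, rfl⟩ := h
  exact ⟨w ≫ e.s, by simp only [Category.assoc, e.symmetry₁],
    by simp only [Category.assoc, e.symmetry₂]⟩

lemma IsEquiv.trans (hR : R.IsEquiv) {x y z : T ⟶ X} (h : R.Rel x y) (h' : R.Rel y z) :
    R.Rel x z := by
  obtain ⟨⟨e⟩⟩ := hR
  obtain ⟨w, rfl, hw⟩ := h
  obtain ⟨w', hw', rfl⟩ := h'
  let l := PullbackCone.IsLimit.lift e.isLimit w w' (hw.trans hw'.symm)
  refine ⟨l ≫ e.t, ?_, ?_⟩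
  · rw [Category.assoc, e.transitivity₁, PullbackCone.IsLimit.lift_fst_assoc]
  · rw [Category.assoc, e.transitivity₂, PullbackCone.IsLimit.lift_snd_assoc]

end IsEquiv

/-- The kernel pair of a morphism, as a relation. -/
def ofKernelPair (r : X ⟶ Y) : Relation X X :=
  Subobject.mk (prod.lift (pullback.fst r r) (pullback.snd r r))

lemma rel_ofKernelPair_iff (r : X ⟶ Y) {x y : T ⟶ X} :
    (ofKernelPair r).Rel x y ↔ x ≫ r = y ≫ r := by
  rw [ofKernelPair, rel_mk_iff]
  constructor
  · rintro ⟨w, hw⟩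
    have h₁ := congr($hw ≫ prod.fst)
    have h₂ := congr($hw ≫ prod.snd)
    simp only [Category.assoc, prod.lift_fst, prod.lift_snd] at h₁ h₂
    rw [← h₁, ← h₂, Category.assoc, Category.assoc, pullback.condition]
  · intro h
    refine ⟨pullback.lift x y h, ?_⟩
    ext <;> simp

lemma isEquiv_ofKernelPair (r : X ⟶ Y) : (ofKernelPair r).IsEquiv := by
  have h : IsKernelPair r (Relation.left (ofKernelPair r)) (Relation.right (ofKernelPair r)) := by
    refine IsPullback.of_iso_pullback
      ⟨(rel_ofKernelPair_iff r).1 (rel_left_right _)⟩ (Subobject.underlyingIso _) ?_ ?_ <;>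
    simp [ofKernelPair, Relation.left, Relation.right, ← Subobject.underlyingIso_hom_comp_eq_mk]
  exact (IsKernelPair.equivalenceRelation r _ _ (pullbackIsPullback _ _) h).isEquivalenceRelation

end Relation

end Relations

/-! ### 3-permutability of kernel pairs and the Shifting Lemma -/

section Permutability

variable {C : Type u} [Category.{v} C] [Regular C]

/-- In a Goursat category kernel pairs are 3-permutable, on generalised elements. -/
lemma IsGoursat.exists_permute (hC : IsGoursat C) {X Y Z T : C} (r : X ⟶ Y) (s : X ⟶ Z)
    {x₀ x₁ x₂ x₃ : T ⟶ X} (h₀ : x₀ ≫ r = x₁ ≫ r) (h₁ : x₁ ≫ s = x₂ ≫ s) (h₂ : x₂ ≫ r = x₃ ≫ r) :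
    ∃ (T' : C) (p : T' ⟶ T) (_ : IsRegularEpi p) (y z : T' ⟶ X),
      p ≫ x₀ ≫ s = y ≫ s ∧ y ≫ r = z ≫ r ∧ z ≫ s = p ≫ x₃ ≫ s := by
  have key := Relation.rel_comp_comp ((Relation.rel_ofKernelPair_iff r).2 h₀)
    ((Relation.rel_ofKernelPair_iff s).2 h₁) ((Relation.rel_ofKernelPair_iff r).2 h₂)
  rw [hC X _ _ (Relation.isEquiv_ofKernelPair r) (Relation.isEquiv_ofKernelPair s)] at key
  obtain ⟨T', p, hp, y, z, hy, hyz, hz⟩ := Relation.exists_of_rel_comp_comp key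
  rw [Relation.rel_ofKernelPair_iff] at hy hyz hz
  exact ⟨T', p, hp, y, z, by simpa using hy, hyz, by simpa using hz⟩

/-- The Shifting Lemma for the kernel pairs of `r`, `s` and `t`. -/
lemma IsGoursat.shifting (hC : IsGoursat C) {X Y Z W T : C} (r : X ⟶ Y) (s : X ⟶ Z) (t : X ⟶ W)
    (hrs : ∀ ⦃T : C⦄ (x y : T ⟶ X), x ≫ r = y ≫ r → x ≫ s = y ≫ s → x ≫ t = y ≫ t)
    {x y x' y' : T ⟶ X} (hx : x ≫ s = x' ≫ s) (hy : y ≫ s = y' ≫ s) (hr : x ≫ r = y ≫ r)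
    (hr' : x' ≫ r = y' ≫ r) (ht : x ≫ t = y ≫ t) : x' ≫ t = y' ≫ t := by
  -- Permute `x' s x (r ∧ t) y s y'` into `x' (r ∧ t) u s v (r ∧ t) y'`. Then `u r v` by way of `x'`
  -- and `y'`, so `u t v` by `hrs`, which joins `x'` to `y'` in `t`.
  obtain ⟨T', p, hp, u, v, hu, huv, hv⟩ := hC.exists_permute s (prod.lift r t)
    hx.symm (by simp [prod.comp_lift, hr, ht]) hy
  have hu₁ := congr($hu ≫ prod.fst)
  have hu₂ := congr($hu ≫ prod.snd)
  have hv₁ := congr($hv ≫ prod.fst)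
  have hv₂ := congr($hv ≫ prod.snd)
  simp only [Category.assoc, prod.lift_fst, prod.lift_snd] at hu₁ hu₂ hv₁ hv₂
  rw [← cancel_epi p, hu₂, ← hv₂]
  exact hrs _ _ (by rw [← hu₁, hv₁, hr']) huv

/-- Let `u` be a split epimorphism lying, along `q` and `f`, over another one. Two generalised
elements whose images under `u` agree after `f` can be moved along `q` so that their images under
`u` agree. -/
lemma IsGoursat.exists_matching (hC : IsGoursat C) {U A B V T : C} (u : U ⟶ A) (s : A ⟶ U)
    (hs : s ≫ u = 𝟙 A) (q : U ⟶ V) (f : A ⟶ B)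
    (hq : ∀ ⦃T : C⦄ (x y : T ⟶ A), x ≫ f = y ≫ f → x ≫ s ≫ q = y ≫ s ≫ q)
    (x y : T ⟶ U) (h : x ≫ u ≫ f = y ≫ u ≫ f) :
    ∃ (T' : C) (p : T' ⟶ T) (_ : IsRegularEpi p) (x' y' : T' ⟶ U),
      x' ≫ u = y' ≫ u ∧ x' ≫ q = p ≫ x ≫ q ∧ y' ≫ q = p ≫ y ≫ q := by
  -- Replacing an element by the section's value at its image does not change `u`, and `hq` makes
  -- `q` identify the two replacements. This is the chain to permute.
  obtain ⟨T', p, hp, x', y', h₁, h₂, h₃⟩ := hC.exists_permute (x₀ := x) (x₁ := x ≫ u ≫ s)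
    (x₂ := y ≫ u ≫ s) (x₃ := y) u q (by simp [hs])
    (by simpa using hq (x ≫ u) (y ≫ u) (by simpa using h)) (by simp [hs])
  exact ⟨T', p, hp, x', y', h₂, h₁.symm, h₃⟩

end Permutability

/-! ### Regular epimorphisms of reflexive graphs are the levelwise ones -/

namespace ReflexiveGraph

section

variable {C : Type u} [Category.{v} C]

@[simp]
lemma e_d_assoc (G : ReflexiveGraph C) {Z : C} (h : G.X₀ ⟶ Z) : G.e ≫ G.d ≫ h = h := by
  rw [← Category.assoc, G.e_d, Category.id_comp]

@[simp]
lemma e_c_assoc (G : ReflexiveGraph C) {Z : C} (h : G.X₀ ⟶ Z) : G.e ≫ G.c ≫ h = h := by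
  rw [← Category.assoc, G.e_c, Category.id_comp]

lemma Hom.comm_d_assoc {G H : ReflexiveGraph C} (f : Hom G H) {Z : C} (h : H.X₀ ⟶ Z) :
    f.f₁ ≫ H.d ≫ h = G.d ≫ f.f₀ ≫ h := by
  rw [← Category.assoc, f.comm_d, Category.assoc]

lemma Hom.comm_c_assoc {G H : ReflexiveGraph C} (f : Hom G H) {Z : C} (h : H.X₀ ⟶ Z) :
    f.f₁ ≫ H.c ≫ h = G.c ≫ f.f₀ ≫ h := by
  rw [← Category.assoc, f.comm_c, Category.assoc]

lemma Hom.comm_e_assoc {G H : ReflexiveGraph C} (f : Hom G H) {Z : C} (h : H.X₁ ⟶ Z) :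
    G.e ≫ f.f₁ ≫ h = f.f₀ ≫ H.e ≫ h := by
  rw [← Category.assoc, f.comm_e, Category.assoc]

@[ext]
lemma hom_ext {G H : ReflexiveGraph C} {f g : G ⟶ H} (h₀ : f.f₀ = g.f₀) (h₁ : f.f₁ = g.f₁) :
    f = g :=
  Hom.ext h₀ h₁

@[simp] lemma comp_f₀ {G H K : ReflexiveGraph C} (f : G ⟶ H) (g : H ⟶ K) :
    (f ≫ g).f₀ = f.f₀ ≫ g.f₀ := rfl
@[simp] lemma comp_f₁ {G H K : ReflexiveGraph C} (f : G ⟶ H) (g : H ⟶ K) :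
    (f ≫ g).f₁ = f.f₁ ≫ g.f₁ := rfl

/-- The kernel pair of a morphism of reflexive graphs, computed levelwise. -/
@[simps]
def kernelPair [HasPullbacks C] {G H : ReflexiveGraph C} (f : G ⟶ H) : ReflexiveGraph C where
  X₀ := pullback f.f₀ f.f₀
  X₁ := pullback f.f₁ f.f₁
  d := pullback.lift (pullback.fst _ _ ≫ G.d) (pullback.snd _ _ ≫ G.d) (by
    simp only [Category.assoc, ← f.comm_d, pullback.condition_assoc])
  c := pullback.lift (pullback.fst _ _ ≫ G.c) (pullback.snd _ _ ≫ G.c) (by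
    simp only [Category.assoc, ← f.comm_c, pullback.condition_assoc])
  e := pullback.lift (pullback.fst _ _ ≫ G.e) (pullback.snd _ _ ≫ G.e) (by
    simp only [Category.assoc, f.comm_e, pullback.condition_assoc])
  e_d := by ext <;> simp
  e_c := by ext <;> simp

/-- The first projection of the kernel pair. -/
def kernelPairFst [HasPullbacks C] {G H : ReflexiveGraph C} (f : G ⟶ H) : kernelPair f ⟶ G :=
  Hom.mk (pullback.fst _ _) (pullback.fst _ _) (by simp [kernelPair]) (by simp [kernelPair])
    (by simp [kernelPair])

/-- The second projection of the kernel pair. -/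
def kernelPairSnd [HasPullbacks C] {G H : ReflexiveGraph C} (f : G ⟶ H) : kernelPair f ⟶ G :=
  Hom.mk (pullback.snd _ _) (pullback.snd _ _) (by simp [kernelPair]) (by simp [kernelPair])
    (by simp [kernelPair])

/-- A morphism of reflexive graphs which is levelwise a regular epimorphism is a regular
epimorphism. -/
lemma isRegularEpi_of_levelwise [HasPullbacks C] {G H : ReflexiveGraph C} (f : G ⟶ H)
    [IsRegularEpi f.f₀] [IsRegularEpi f.f₁] : IsRegularEpi f := by
  have w : kernelPairFst f ≫ f = kernelPairSnd f ≫ f :=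
    hom_ext pullback.condition pullback.condition
  have epi₀ : Epi f.f₀ := inferInstance
  have epi₁ : Epi f.f₁ := inferInstance
  have key : ∀ s : Cofork (kernelPairFst f) (kernelPairSnd f), ∃ l : H ⟶ s.pt, f ≫ l = s.π := by
    intro s
    have s₀ : pullback.fst f.f₀ f.f₀ ≫ s.π.f₀ = pullback.snd f.f₀ f.f₀ ≫ s.π.f₀ :=
      congr(Hom.f₀ $s.condition)
    have s₁ : pullback.fst f.f₁ f.f₁ ≫ s.π.f₁ = pullback.snd f.f₁ f.f₁ ≫ s.π.f₁ :=
      congr(Hom.f₁ $s.condition)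
    obtain ⟨g₀, hg₀⟩ := exists_descent f.f₀ s.π.f₀ fun T x y h => by
      simpa using congr(pullback.lift x y h ≫ $s₀)
    obtain ⟨g₁, hg₁⟩ := exists_descent f.f₁ s.π.f₁ fun T x y h => by
      simpa using congr(pullback.lift x y h ≫ $s₁)
    refine ⟨Hom.mk g₀ g₁ ?_ ?_ ?_, hom_ext hg₀ hg₁⟩
    · rw [← cancel_epi f.f₁, reassoc_of% hg₁, f.comm_d_assoc, hg₀, s.π.comm_d]
    · rw [← cancel_epi f.f₁, reassoc_of% hg₁, f.comm_c_assoc, hg₀, s.π.comm_c]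
    · rw [← cancel_epi f.f₀, reassoc_of% hg₀, ← f.comm_e_assoc, hg₁, s.π.comm_e]
  choose l hl using key
  exact ⟨⟨⟨_, kernelPairFst f, kernelPairSnd f, w,
    Cofork.IsColimit.mk _ l hl fun s m hm => hom_ext
      (by rw [← cancel_epi f.f₀]; exact congr(Hom.f₀ $(hm.trans (hl s).symm)))
      (by rw [← cancel_epi f.f₁]; exact congr(Hom.f₁ $(hm.trans (hl s).symm)))⟩⟩⟩

end

variable {C : Type u} [Category.{v} C] [Regular C]

/-- Morphisms of reflexive graphs factor as a levelwise regular epimorphism followed by a levelwise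
monomorphism. -/
lemma exists_levelwise_factorisation {G H : ReflexiveGraph C} (f : G ⟶ H) :
    ∃ (I : ReflexiveGraph C) (q : G ⟶ I) (i : I ⟶ H), q ≫ i = f ∧
      IsRegularEpi q.f₀ ∧ IsRegularEpi q.f₁ ∧ Mono i.f₀ ∧ Mono i.f₁ := by
  -- The graph structure on the images comes from diagonal fill-ins of regular epimorphisms against
  -- monomorphisms.
  have sd : CommSq (G.d ≫ factorThruImage f.f₀) (factorThruImage f.f₁) (image.ι f.f₀)
      (image.ι f.f₁ ≫ H.d) := ⟨by simp [f.comm_d]⟩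
  have sc : CommSq (G.c ≫ factorThruImage f.f₀) (factorThruImage f.f₁) (image.ι f.f₀)
      (image.ι f.f₁ ≫ H.c) := ⟨by simp [f.comm_c]⟩
  have se : CommSq (G.e ≫ factorThruImage f.f₁) (factorThruImage f.f₀) (image.ι f.f₁)
      (image.ι f.f₀ ≫ H.e) := ⟨by simp [f.comm_e]⟩
  let I : ReflexiveGraph C :=
    { X₀ := image f.f₀
      X₁ := image f.f₁
      d := sd.lift
      c := sc.lift
      e := se.lift
      e_d := by rw [← cancel_mono (image.ι f.f₀)]; simp
      e_c := by rw [← cancel_mono (image.ι f.f₀)]; simp }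
  refine ⟨I, Hom.mk (factorThruImage f.f₀) (factorThruImage f.f₁) sd.fac_left sc.fac_left
    se.fac_left.symm, Hom.mk (image.ι f.f₀) (image.ι f.f₁) sd.fac_right.symm sc.fac_right.symm
    se.fac_right, hom_ext (image.fac _) (image.fac _), ?_, ?_, ?_, ?_⟩
  all_goals dsimp; infer_instance

/-- A regular epimorphism of reflexive graphs is levelwise a regular epimorphism. -/
lemma levelwise_of_isRegularEpi {G H : ReflexiveGraph C} (f : G ⟶ H) [IsRegularEpi f] :
    IsRegularEpi f.f₀ ∧ IsRegularEpi f.f₁ := by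
  obtain ⟨I, q, i, rfl, h₀, h₁, m₀, m₁⟩ := exists_levelwise_factorisation f
  -- As `i` is levelwise monic, `q` coequalises the pair of which `q ≫ i` is the coequaliser. The
  -- induced `l` is a section of `i`, so `i` is levelwise split epi.
  have w : IsRegularEpi.left (q ≫ i) ≫ q = IsRegularEpi.right (q ≫ i) ≫ q := by
    have w' := IsRegularEpi.w (q ≫ i)
    ext
    · rw [← cancel_mono i.f₀]; simpa using congr(Hom.f₀ $w')
    · rw [← cancel_mono i.f₁]; simpa using congr(Hom.f₁ $w')
  have fac := IsRegularEpi.fac (q ≫ i) q w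
  set l := IsRegularEpi.desc (q ≫ i) q w
  have epi : Epi (q ≫ i) := inferInstance
  have hl : l ≫ i = 𝟙 H := by rw [← cancel_epi (q ≫ i), ← Category.assoc, fac, Category.comp_id]
  have s₀ : l.f₀ ≫ i.f₀ = 𝟙 _ := congr(Hom.f₀ $hl)
  have s₁ : l.f₁ ≫ i.f₁ = 𝟙 _ := congr(Hom.f₁ $hl)
  have : IsSplitEpi i.f₀ := ⟨⟨⟨_, s₀⟩⟩⟩
  have : IsSplitEpi i.f₁ := ⟨⟨⟨_, s₁⟩⟩⟩
  exact ⟨isRegularEpi_comp q.f₀ i.f₀, isRegularEpi_comp q.f₁ i.f₁⟩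

end ReflexiveGraph

/-! ### Internal categories in a Goursat category are groupoids -/

namespace InternalCategory

section Elements

variable {C : Type u} [Category.{v} C] [HasPullbacks C] {G : ReflexiveGraph C}
  (S : InternalCategory G) {T T' : C}

/-- The composite "first `a`, then `b`" of generalised arrows. -/
def mul (a b : T ⟶ G.X₁) (h : a ≫ G.c = b ≫ G.d) : T ⟶ G.X₁ := pullback.lift a b h ≫ S.m

@[simp]
lemma mul_d (a b : T ⟶ G.X₁) (h : a ≫ G.c = b ≫ G.d) : S.mul a b h ≫ G.d = a ≫ G.d := by
  simp [mul, S.m_d]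

@[simp]
lemma mul_c (a b : T ⟶ G.X₁) (h : a ≫ G.c = b ≫ G.d) : S.mul a b h ≫ G.c = b ≫ G.c := by
  simp [mul, S.m_c]

lemma comp_mul (t : T' ⟶ T) (a b : T ⟶ G.X₁) (h : a ≫ G.c = b ≫ G.d) :
    t ≫ S.mul a b h = S.mul (t ≫ a) (t ≫ b) (by simp [h]) := by
  have : t ≫ pullback.lift a b h = pullback.lift (t ≫ a) (t ≫ b) (by simp [h]) := by
    ext <;> simp
  rw [mul, ← Category.assoc, this, mul]

lemma mul_congr {a a' b b' : T ⟶ G.X₁} (ha : a = a') (hb : b = b') (h : a ≫ G.c = b ≫ G.d) :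
    S.mul a b h = S.mul a' b' (by rw [← ha, ← hb, h]) := by
  subst ha hb
  rfl

lemma id_mul (x : T ⟶ G.X₀) (a : T ⟶ G.X₁) (h : (x ≫ G.e) ≫ G.c = a ≫ G.d) :
    S.mul (x ≫ G.e) a h = a := by
  have hx : x = a ≫ G.d := by simpa using h
  subst hx
  have key : S.mul (G.d ≫ G.e) (𝟙 G.X₁) (by simp) = 𝟙 G.X₁ := S.id_m
  have := congr(a ≫ $key)
  rw [S.comp_mul] at this
  exact (S.mul_congr (by simp) (by simp) _).trans (this.trans (Category.comp_id a))

lemma mul_id (a : T ⟶ G.X₁) (x : T ⟶ G.X₀) (h : a ≫ G.c = (x ≫ G.e) ≫ G.d) :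
    S.mul a (x ≫ G.e) h = a := by
  have hx : x = a ≫ G.c := by simpa using h.symm
  subst hx
  have key : S.mul (𝟙 G.X₁) (G.c ≫ G.e) (by simp) = 𝟙 G.X₁ := S.m_id
  have := congr(a ≫ $key)
  rw [S.comp_mul] at this
  exact (S.mul_congr (by simp) (by simp) _).trans (this.trans (Category.comp_id a))

/-- A generalised composable triple. -/
def triple (a b c : T ⟶ G.X₁) (h : a ≫ G.c = b ≫ G.d) (h' : b ≫ G.c = c ≫ G.d) :
    T ⟶ G.triples :=
  pullback.lift (pullback.lift a b h) (pullback.lift b c h') (by simp)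

lemma exists_eq_triple (t : T ⟶ G.triples) :
    ∃ (a b c : T ⟶ G.X₁) (h : a ≫ G.c = b ≫ G.d) (h' : b ≫ G.c = c ≫ G.d),
      t = triple a b c h h' := by
  refine ⟨t ≫ pullback.fst _ _ ≫ pullback.fst _ _, t ≫ pullback.fst _ _ ≫ pullback.snd _ _,
    t ≫ pullback.snd _ _ ≫ pullback.snd _ _, ?_, ?_, ?_⟩
  · simp only [Category.assoc, pullback.condition (f := G.c) (g := G.d)]
  · simp only [Category.assoc, pullback.condition_assoc (f := pullback.snd G.c G.d),
      pullback.condition (f := G.c) (g := G.d)]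
  · apply pullback.hom_ext <;> apply pullback.hom_ext <;> simp [triple, pullback.condition]

lemma mul_assoc (a b c : T ⟶ G.X₁) (h : a ≫ G.c = b ≫ G.d) (h' : b ≫ G.c = c ≫ G.d) :
    S.mul (S.mul a b h) c (by simpa using h') = S.mul a (S.mul b c h') (by simpa using h) := by
  have key : S.mul _ _ _ = S.mul _ _ _ := S.assoc
  have := congr(triple a b c h h' ≫ $key)
  rw [S.comp_mul, S.comp_mul] at this
  refine (S.mul_congr ?_ ?_ _).trans (this.symm.trans (S.mul_congr ?_ ?_ _)) <;>
    simp [triple, mul]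

/-- Mutually inverse generalised arrows. -/
structure IsInverse (a b : T ⟶ G.X₁) : Prop where
  hc : a ≫ G.c = b ≫ G.d
  hd : b ≫ G.c = a ≫ G.d
  mul_inv : S.mul a b hc = (a ≫ G.d) ≫ G.e
  inv_mul : S.mul b a hd = (b ≫ G.d) ≫ G.e

variable {S}

lemma IsInverse.precomp {a b : T ⟶ G.X₁} (h : S.IsInverse a b) (t : T' ⟶ T) :
    S.IsInverse (t ≫ a) (t ≫ b) where
  hc := by simp [h.hc]
  hd := by simp [h.hd]
  mul_inv := by rw [← comp_mul S t a b h.hc, h.mul_inv]; simp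
  inv_mul := by rw [← comp_mul S t b a h.hd, h.inv_mul]; simp

/-- Both sides are values of `abc` under the two bracketings. -/
lemma eq_of_mul_eq_id {a b c : T ⟶ G.X₁} (h : a ≫ G.c = b ≫ G.d) (h' : b ≫ G.c = c ≫ G.d)
    (hab : S.mul a b h = (a ≫ G.d) ≫ G.e) (hbc : S.mul b c h' = (b ≫ G.d) ≫ G.e) : a = c := by
  have := S.mul_assoc a b c h h'
  rw [S.mul_congr hab rfl, S.mul_congr rfl hbc, S.id_mul, S.mul_id] at this
  exact this.symm

lemma IsInverse.unique {a b b' : T ⟶ G.X₁} (h : S.IsInverse a b) (h' : S.IsInverse a b') :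
    b = b' :=
  eq_of_mul_eq_id h.hd h'.hc h.inv_mul h'.mul_inv

end Elements

section

variable {C : Type u} [Category.{v} C] [Regular C] {G : ReflexiveGraph C}

/-- In a Goursat category the arrows of an internal category have right inverses, locally. -/
lemma exists_local_right_inverse (hC : IsGoursat C) (S : InternalCategory G) {T : C}
    (a : T ⟶ G.X₁) :
    ∃ (T' : C) (p : T' ⟶ T) (_ : IsRegularEpi p) (b : T' ⟶ G.X₁)
      (h : (p ≫ a) ≫ G.c = b ≫ G.d), S.mul (p ≫ a) b h = ((p ≫ a) ≫ G.d) ≫ G.e := by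
  let g : G.triples ⟶ G.X₁ := pullback.fst _ _ ≫ pullback.fst _ _
  let gh : G.triples ⟶ G.X₁ := pullback.fst _ _ ≫ S.m
  let ghk : G.triples ⟶ G.X₁ := pullback.lift gh (pullback.snd _ _ ≫ pullback.snd _ _) (by
    simp only [gh, Category.assoc, S.m_c, ← pullback.condition, pullback.condition_assoc]) ≫ S.m
  have eg {T : C} (a b c : T ⟶ G.X₁) (h) (h') : triple a b c h h' ≫ g = a := by simp [triple, g]
  have egh {T : C} (a b c : T ⟶ G.X₁) (h) (h') : triple a b c h h' ≫ gh = S.mul a b h := by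
    simp [triple, gh, mul]
  have eghk {T : C} (a b c : T ⟶ G.X₁) (h) (h') : triple a b c h h' ≫ ghk =
      S.mul (S.mul a b h) c (by simpa using h') := by
    rw [← Category.assoc, mul]
    congr 1
    ext
    · simp [triple, gh, mul]
    · simp [triple]
  -- The chain is `(a,1,1)`, `(1,a,1)`, `(1,1,a)`, `(1,1,1)`: its outer links preserve `gh`, its
  -- middle link preserves `g` and `ghk`. Permuting yields `y = (a,b₁,c₁)` and `z = (1,b₂,c₂)` with
  -- `a b₁ = 1 b₂` and `1 b₂ c₂ = 1`.
  obtain ⟨T', p, hp, y, z, hy, hyz, hz⟩ := hC.exists_permute gh (prod.lift g ghk)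
    (x₀ := triple a ((a ≫ G.c) ≫ G.e) ((a ≫ G.c) ≫ G.e) (by simp) (by simp))
    (x₁ := triple ((a ≫ G.d) ≫ G.e) a ((a ≫ G.c) ≫ G.e) (by simp) (by simp))
    (x₂ := triple ((a ≫ G.d) ≫ G.e) ((a ≫ G.d) ≫ G.e) a (by simp) (by simp))
    (x₃ := triple ((a ≫ G.d) ≫ G.e) ((a ≫ G.d) ≫ G.e) ((a ≫ G.d) ≫ G.e) (by simp) (by simp))
    (by rw [egh, egh, S.mul_id, S.id_mul])
    (by
      rw [prod.comp_lift, prod.comp_lift, eg, eg, eghk, eghk, S.mul_id, S.id_mul]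
      rw [S.mul_congr (S.id_mul _ _ _) rfl, S.id_mul])
    (by rw [egh, egh])
  obtain ⟨a₁, b₁, c₁, h₁, h₁', rfl⟩ := exists_eq_triple y
  obtain ⟨a₂, b₂, c₂, h₂, h₂', rfl⟩ := exists_eq_triple z
  have hy₁ := congr($hy ≫ prod.fst)
  have hz₁ := congr($hz ≫ prod.fst)
  have hz₂ := congr($hz ≫ prod.snd)
  simp only [Category.assoc, prod.lift_fst, prod.lift_snd, eg, egh, eghk] at hy₁ hz₁ hz₂ hyz
  subst hy₁
  have hbc : b₁ ≫ G.c = c₂ ≫ G.d := by simpa [h₂'] using congr($hyz ≫ G.c)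
  refine ⟨T', p, hp, S.mul b₁ c₂ hbc, by simpa using h₁, ?_⟩
  have hid := S.mul_id ((a ≫ G.d) ≫ G.e) (a ≫ G.d) (by simp)
  simp only [Category.assoc] at hid
  -- `a (b₁ c₂) = (a b₁) c₂ = (1 b₂) c₂ = 1`.
  rw [← S.mul_assoc _ _ _ h₁, S.mul_congr hyz rfl, hz₂, S.mul_congr hid rfl, hid]
  simp

/-- In a Goursat category the arrows of an internal category are invertible. -/
lemma exists_inverse (hC : IsGoursat C) (S : InternalCategory G) {T : C} (a : T ⟶ G.X₁) :
    ∃ b : T ⟶ G.X₁, S.IsInverse a b := by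
  obtain ⟨T₁, p, hp, b, h, hb⟩ := exists_local_right_inverse hC S a
  obtain ⟨T₂, q, hq, c, h', hc⟩ := exists_local_right_inverse hC S b
  have hb' := congr(q ≫ $hb)
  rw [S.comp_mul] at hb'
  -- A right inverse `b` of `a` has itself a right inverse `c`; then `c` must be `a`, and `b` is
  -- two-sided.
  have hac : q ≫ p ≫ a = c :=
    eq_of_mul_eq_id (by simpa using congr(q ≫ $h)) h' (by simpa using hb') hc
  have inv : S.IsInverse ((q ≫ p) ≫ a) (q ≫ b) :=
    { hc := by simpa using congr(q ≫ $h)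
      hd := by simp [h', hac]
      mul_inv := by simpa using hb'
      inv_mul := by
        rw [← hc]
        exact S.mul_congr rfl (by simpa using hac) _ }
  have hqp := isRegularEpi_comp q p
  -- Two-sided inverses are unique, so the local one descends to a global one.
  obtain ⟨i, hi⟩ := exists_descent (q ≫ p) (q ≫ b) fun T x y hxy => by
    have h₁ := inv.precomp x
    have h₂ := inv.precomp y
    rw [← Category.assoc] at h₁ h₂
    rw [hxy] at h₁
    exact h₁.unique h₂
  rw [← hi] at inv
  have epi : Epi (q ≫ p) := inferInstance
  have hc : a ≫ G.c = i ≫ G.d := by rw [← cancel_epi (q ≫ p)]; simpa using inv.hc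
  have hd : i ≫ G.c = a ≫ G.d := by rw [← cancel_epi (q ≫ p)]; simpa using inv.hd
  refine ⟨i, hc, hd, ?_, ?_⟩
  · rw [← cancel_epi (q ≫ p), S.comp_mul, inv.mul_inv]; simp
  · rw [← cancel_epi (q ≫ p), S.comp_mul, inv.inv_mul]; simp

/-- In a Goursat category every internal category is an internal groupoid. -/
lemma nonempty_internalGroupoid (hC : IsGoursat C) (S : InternalCategory G) :
    Nonempty (InternalGroupoid G) := by
  obtain ⟨i, hi⟩ := exists_inverse hC S (𝟙 G.X₁)
  have hd := hi.hc
  have hc := hi.hd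
  rw [Category.id_comp] at hd hc
  exact ⟨{ S with
    i := i
    i_d := hd.symm
    i_c := hc
    i_m := by simpa [mul, ← hd] using hi.inv_mul
    m_i := by simpa [mul] using hi.mul_inv }⟩

end

end InternalCategory

/-! ### Inversion in an internal groupoid -/

section

variable {C : Type u} [Category.{v} C] [HasPullbacks C] {G : ReflexiveGraph C}

@[simp]
lemma InternalGroupoid.i_d_assoc (S : InternalGroupoid G) {Z : C} (k : G.X₀ ⟶ Z) :
    S.i ≫ G.d ≫ k = G.c ≫ k := by
  rw [← Category.assoc, S.i_d]

@[simp]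
lemma InternalGroupoid.i_c_assoc (S : InternalGroupoid G) {Z : C} (k : G.X₀ ⟶ Z) :
    S.i ≫ G.c ≫ k = G.d ≫ k := by
  rw [← Category.assoc, S.i_c]

attribute [local simp] InternalGroupoid.i_d InternalGroupoid.i_c

lemma InternalGroupoid.isInverse (S : InternalGroupoid G) {T : C} (a : T ⟶ G.X₁) :
    S.IsInverse a (a ≫ S.i) := by
  have : S.IsInverse (𝟙 G.X₁) S.i :=
    { hc := by simp
      hd := by simp
      mul_inv := by simpa [InternalCategory.mul] using S.m_i
      inv_mul := by simpa [InternalCategory.mul] using S.i_m }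
  simpa using this.precomp a

@[simp]
lemma InternalGroupoid.i_i (S : InternalGroupoid G) : S.i ≫ S.i = 𝟙 G.X₁ := by
  have h := S.isInverse (𝟙 G.X₁)
  have h' := S.isInverse S.i
  rw [Category.id_comp] at h
  exact h'.unique ⟨h.hd, h.hc, h.inv_mul, h.mul_inv⟩

@[simp]
lemma InternalGroupoid.i_i_assoc (S : InternalGroupoid G) {Z : C} (k : G.X₁ ⟶ Z) :
    S.i ≫ S.i ≫ k = k := by
  rw [← Category.assoc, S.i_i, Category.id_comp]

lemma InternalCategory.lift_m_comp (S : InternalCategory G) {T Z : C} (a b : T ⟶ G.X₁)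
    (h : a ≫ G.c = b ≫ G.d) (k : G.X₁ ⟶ Z) :
    pullback.lift a b h ≫ S.m ≫ k = S.mul a b h ≫ k := by
  rw [mul, Category.assoc]

end

/-! ### Quotients of internal groupoids in a Goursat category -/

section

variable {C : Type u} [Category.{v} C] [Regular C] {G H : ReflexiveGraph C}

attribute [local simp] InternalGroupoid.i_d InternalGroupoid.i_c

/-- In a Goursat category, multiplication on the left respects every kernel pair. -/
lemma InternalCategory.mul_left_compat (hC : IsGoursat C) (S : InternalCategory G) {T Y : C}
    (k : G.X₁ ⟶ Y) {a b b' : T ⟶ G.X₁} (h : a ≫ G.c = b ≫ G.d) (h' : a ≫ G.c = b' ≫ G.d)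
    (hb : b ≫ k = b' ≫ k) : S.mul a b h ≫ k = S.mul a b' h' ≫ k := by
  -- Shift `(1,b)`, `(1,b')` to `(a,b)`, `(a,b')`; the two projections are jointly monic.
  have := hC.shifting (pullback.fst G.c G.d) (pullback.snd G.c G.d) (S.m ≫ k)
    (fun T x y h₁ h₂ => by rw [pullback.hom_ext h₁ h₂])
    (x := pullback.lift ((b ≫ G.d) ≫ G.e) b (by simp))
    (y := pullback.lift ((b' ≫ G.d) ≫ G.e) b' (by simp))
    (x' := pullback.lift a b h) (y' := pullback.lift a b' h')
    (by simp) (by simp) (by simp [← h, ← h']) (by simp) (by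
      rw [S.lift_m_comp, S.lift_m_comp, S.id_mul, S.id_mul, hb])
  simpa [mul] using this

/-- In a Goursat category, the multiplication of an internal category respects the kernel pair of
every morphism of reflexive graphs. -/
lemma InternalCategory.mul_compat (hC : IsGoursat C) (S : InternalCategory G) (f : G ⟶ H) {T : C}
    {a a' b b' : T ⟶ G.X₁} (h : a ≫ G.c = b ≫ G.d) (h' : a' ≫ G.c = b' ≫ G.d)
    (ha : a ≫ f.f₁ = a' ≫ f.f₁) (hb : b ≫ f.f₁ = b' ≫ f.f₁) :
    S.mul a b h ≫ f.f₁ = S.mul a' b' h' ≫ f.f₁ := by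
  have hd : b ≫ G.d ≫ f.f₀ = b' ≫ G.d ≫ f.f₀ := by
    rw [← f.comm_d, reassoc_of% hb]
  -- Shift `(a,1)`, `(a',1)` to `(a,b)`, `(a',b')`. The hypothesis on the meet is `mul_left_compat`:
  -- a common first factor, and second factors identified by `f`.
  have := hC.shifting (pullback.snd G.c G.d ≫ f.f₁) (pullback.fst G.c G.d) (S.m ≫ f.f₁)
    (fun T x y h₁ h₂ => by
      have key := S.mul_left_compat hC f.f₁ (a := x ≫ pullback.fst _ _) (b := x ≫ pullback.snd _ _)
        (b' := y ≫ pullback.snd _ _) (by simp [pullback.condition])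
        (by rw [h₂]; simp [pullback.condition]) (by simpa using h₁)
      rw [S.mul_congr h₂ rfl] at key
      simp only [mul, Category.assoc] at key
      convert key using 2 <;> ext <;> simp [h₂])
    (x := pullback.lift a ((b ≫ G.d) ≫ G.e) (by simp [h]))
    (y := pullback.lift a' ((b' ≫ G.d) ≫ G.e) (by simp [h']))
    (x' := pullback.lift a b h) (y' := pullback.lift a' b' h')
    (by simp) (by simp) (by simp [f.comm_e, reassoc_of% hd]) (by simpa using hb) (by
      rw [S.lift_m_comp, S.lift_m_comp, S.mul_id, S.mul_id, ha])
  simpa [mul] using this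

/-- In a Goursat category, the inversion of an internal groupoid respects the kernel pair of
every morphism of reflexive graphs. -/
lemma InternalGroupoid.inv_compat (hC : IsGoursat C) (S : InternalGroupoid G) (f : G ⟶ H) {T : C}
    {a a' : T ⟶ G.X₁} (ha : a ≫ f.f₁ = a' ≫ f.f₁) :
    a ≫ S.i ≫ f.f₁ = a' ≫ S.i ≫ f.f₁ := by
  have hd : a ≫ G.d ≫ f.f₀ = a' ≫ G.d ≫ f.f₀ := by
    rw [← f.comm_d, reassoc_of% ha]
  have hc : a ≫ G.c ≫ f.f₀ = a' ≫ G.c ≫ f.f₀ := by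
    rw [← f.comm_c, reassoc_of% ha]
  -- Left division `(x, y) ↦ x⁻¹ y` on arrows with a common domain; its value at `(a,1)` is `a⁻¹`.
  let div : pullback G.d G.d ⟶ G.X₁ :=
    S.mul (pullback.fst _ _ ≫ S.i) (pullback.snd _ _) (by simp [pullback.condition])
  have hdiv {T : C} (x y : T ⟶ G.X₁) (h : x ≫ G.d = y ≫ G.d) :
      pullback.lift x y h ≫ div ≫ f.f₁ = S.mul (x ≫ S.i) y (by simpa using h) ≫ f.f₁ := by
    rw [← S.mul_congr (a := pullback.lift x y h ≫ pullback.fst _ _ ≫ S.i)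
      (b := pullback.lift x y h ≫ pullback.snd _ _) (by simp) (by simp) (by simpa using h),
      ← S.comp_mul, Category.assoc]
  have hself (x : T ⟶ G.X₁) : S.mul (x ≫ S.i) x (by simp) = (x ≫ G.c) ≫ G.e := by
    simpa using (S.isInverse x).inv_mul
  -- Shift `(a,a)`, `(a',a')`, where division gives identities that `f` identifies, to `(a,1)`,
  -- `(a',1)`.
  have := hC.shifting (pullback.snd G.d G.d ≫ f.f₁) (pullback.fst G.d G.d) (div ≫ f.f₁)
    (fun T x y h₁ h₂ => by
      have key := S.mul_left_compat hC f.f₁ (a := x ≫ pullback.fst _ _ ≫ S.i)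
        (b := x ≫ pullback.snd _ _)
        (b' := y ≫ pullback.snd _ _) (by simp [pullback.condition])
        (by simp [reassoc_of% h₂, pullback.condition]) (by simpa using h₁)
      rw [S.mul_congr (a := x ≫ pullback.fst _ _ ≫ S.i) (by rw [reassoc_of% h₂]) rfl] at key
      rw [← Category.assoc, ← Category.assoc, S.comp_mul, S.comp_mul]
      convert key using 2 <;> simp [reassoc_of% h₂])
    (x := pullback.lift a a rfl) (y := pullback.lift a' a' rfl)
    (x' := pullback.lift a ((a ≫ G.d) ≫ G.e) (by simp))
    (y' := pullback.lift a' ((a' ≫ G.d) ≫ G.e) (by simp))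
    (by simp) (by simp) (by simpa using ha) (by simp [f.comm_e, reassoc_of% hd]) (by
      rw [hdiv, hdiv, hself, hself]
      simp [f.comm_e, reassoc_of% hc])
  rw [hdiv, hdiv, S.mul_id, S.mul_id] at this
  simpa using this

/-- Generalised composable pairs lift locally along a quotient of an internal groupoid. -/
lemma InternalGroupoid.exists_local_lift_pair (hC : IsGoursat C) (S : InternalGroupoid G)
    (f : G ⟶ H) [IsRegularEpi f.f₁] {T : C} (x y : T ⟶ H.X₁) (h : x ≫ H.c = y ≫ H.d) :
    ∃ (T' : C) (p : T' ⟶ T) (_ : IsRegularEpi p) (a b : T' ⟶ G.X₁),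
      a ≫ G.c = b ≫ G.d ∧ a ≫ f.f₁ = p ≫ x ∧ b ≫ f.f₁ = p ≫ y := by
  obtain ⟨T₁, p₁, hp₁, a, ha⟩ := exists_local_lift f.f₁ x
  obtain ⟨T₂, p₂, hp₂, b, hb⟩ := exists_local_lift f.f₁ (p₁ ≫ y)
  -- Matching works for elements of one split epimorphism, here `d`. Hence `a` is inverted first,
  -- and `inv_compat` controls the image after inverting back.
  obtain ⟨T₃, p₃, hp₃, a', b', hd, ha', hb'⟩ := hC.exists_matching G.d G.e G.e_d f.f₁ f.f₀
    (fun T u v huv => by simp [f.comm_e, reassoc_of% huv]) (p₂ ≫ a ≫ S.i) b (by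
      simp only [Category.assoc, i_d_assoc]
      rw [← f.comm_c, ← f.comm_d, reassoc_of% ha, reassoc_of% hb, h])
  have := isRegularEpi_comp p₂ p₁
  refine ⟨T₃, p₃ ≫ p₂ ≫ p₁, isRegularEpi_comp _ _, a' ≫ S.i, b', by simpa using hd, ?_, ?_⟩
  · have := S.inv_compat hC f (a := a') (a' := p₃ ≫ p₂ ≫ a ≫ S.i) (by simpa using ha')
    simp only [Category.assoc] at this ⊢
    rw [this, ← ha, S.i_i_assoc]
  · rw [hb', hb]
    simp

/-- Generalised composable triples lift locally along a quotient of an internal groupoid. -/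
lemma InternalGroupoid.exists_local_lift_triple (hC : IsGoursat C) (S : InternalGroupoid G)
    (f : G ⟶ H) [IsRegularEpi f.f₁] {T : C} (x y z : T ⟶ H.X₁) (h : x ≫ H.c = y ≫ H.d)
    (h' : y ≫ H.c = z ≫ H.d) :
    ∃ (T' : C) (p : T' ⟶ T) (_ : IsRegularEpi p) (a b c : T' ⟶ G.X₁),
      a ≫ G.c = b ≫ G.d ∧ b ≫ G.c = c ≫ G.d ∧
        a ≫ f.f₁ = p ≫ x ∧ b ≫ f.f₁ = p ≫ y ∧ c ≫ f.f₁ = p ≫ z := by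
  obtain ⟨T₁, p₁, hp₁, a, ha⟩ := exists_local_lift f.f₁ x
  obtain ⟨T₂, p₂, hp₂, b, c, hbc, hb, hc⟩ :=
    S.exists_local_lift_pair hC f (p₁ ≫ y) (p₁ ≫ z) (by simp [h'])
  -- Here the elements are composable pairs over their initial domain, so that `b` and `c` move
  -- together and stay composable. The identity only completes `a⁻¹` to a pair.
  obtain ⟨T₃, p₃, hp₃, u, w, hd, hu, hw⟩ := hC.exists_matching
    (pullback.fst G.c G.d ≫ G.d) (pullback.lift G.e G.e (by simp)) (by simp)
    (prod.lift (pullback.fst _ _ ≫ f.f₁) (pullback.snd _ _ ≫ f.f₁)) f.f₀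
    (fun T u v huv => by simp [prod.comp_lift, f.comm_e, reassoc_of% huv])
    (pullback.lift (p₂ ≫ a ≫ S.i) ((p₂ ≫ a ≫ G.d) ≫ G.e) (by simp)) (pullback.lift b c hbc) (by
      simp only [Category.assoc, pullback.lift_fst_assoc, i_d_assoc]
      rw [← f.comm_c, ← f.comm_d, reassoc_of% ha, reassoc_of% hb, h])
  have hu₁ := congr($hu ≫ prod.fst)
  have hw₁ := congr($hw ≫ prod.fst)
  have hw₂ := congr($hw ≫ prod.snd)
  simp only [Category.assoc, prod.lift_fst, prod.lift_snd, pullback.lift_fst_assoc,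
    pullback.lift_snd_assoc] at hu₁ hw₁ hw₂
  have := isRegularEpi_comp p₂ p₁
  refine ⟨T₃, p₃ ≫ p₂ ≫ p₁, isRegularEpi_comp _ _, u ≫ pullback.fst _ _ ≫ S.i,
    w ≫ pullback.fst _ _, w ≫ pullback.snd _ _, by simpa using hd, by simp [pullback.condition],
    ?_, ?_, ?_⟩
  · have := S.inv_compat hC f (a := u ≫ pullback.fst _ _) (a' := p₃ ≫ p₂ ≫ a ≫ S.i)
      (by simpa using hu₁)
    simp only [Category.assoc] at this ⊢
    rw [this, ← ha, S.i_i_assoc]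
  · simp [hw₁, hb]
  · simp [hw₂, hc]

/-- In a Goursat category the quotients of internal groupoids are internal groupoids. -/
lemma nonempty_internalGroupoid_of_quotient (hC : IsGoursat C) (S : InternalGroupoid G)
    (f : G ⟶ H) [IsRegularEpi f.f₀] [IsRegularEpi f.f₁] : Nonempty (InternalGroupoid H) := by
  let φ : G.pairs ⟶ H.pairs := pullback.lift (pullback.fst _ _ ≫ f.f₁) (pullback.snd _ _ ≫ f.f₁)
    (by simp [f.comm_c, f.comm_d, pullback.condition_assoc])
  have : IsRegularEpi φ := by
    -- Lifting the universal composable pair of `H` locally makes a regular epimorphism factor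
    -- through `φ`.
    obtain ⟨T, p, hp, a, b, hab, ha, hb⟩ := S.exists_local_lift_pair hC f
      (pullback.fst H.c H.d) (pullback.snd H.c H.d) pullback.condition
    exact isRegularEpi_of_fac φ p (pullback.lift a b hab) (by ext <;> simp [φ, ha, hb])
  obtain ⟨m, hm⟩ := exists_descent φ (S.m ≫ f.f₁) fun T x y hxy => by
    have h₁ := congr($hxy ≫ pullback.fst _ _)
    have h₂ := congr($hxy ≫ pullback.snd _ _)
    simp only [φ, Category.assoc, pullback.lift_fst, pullback.lift_snd] at h₁ h₂
    have := S.mul_compat hC f (a := x ≫ pullback.fst _ _) (b := x ≫ pullback.snd _ _)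
      (a' := y ≫ pullback.fst _ _) (b' := y ≫ pullback.snd _ _) (by simp [pullback.condition])
      (by simp [pullback.condition]) (by simpa using h₁) (by simpa using h₂)
    simp only [InternalCategory.mul, Category.assoc] at this
    convert this using 2 <;> ext <;> simp
  obtain ⟨i, hi⟩ := exists_descent f.f₁ (S.i ≫ f.f₁) fun T x y hxy => S.inv_compat hC f hxy
  have hmul {T T' : C} (p : T' ⟶ T) (t : T ⟶ H.pairs) (a b : T' ⟶ G.X₁) (h : a ≫ G.c = b ≫ G.d)
      (ha : p ≫ t ≫ pullback.fst _ _ = a ≫ f.f₁) (hb : p ≫ t ≫ pullback.snd _ _ = b ≫ f.f₁) :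
      p ≫ t ≫ m = S.mul a b h ≫ f.f₁ := by
    have : p ≫ t = pullback.lift a b h ≫ φ := by ext <;> simp [φ, ha, hb]
    rw [reassoc_of% this, hm, S.lift_m_comp]
  have epi₁ : Epi f.f₁ := inferInstance
  have epi : Epi φ := inferInstance
  refine ⟨{ m := m, i := i, m_d := ?_, m_c := ?_, id_m := ?_, m_id := ?_, assoc := ?_,
            i_d := ?_, i_c := ?_, i_m := ?_, m_i := ?_ }⟩
  · rw [← cancel_epi φ, reassoc_of% hm]
    simp [φ, f.comm_d, reassoc_of% S.m_d]
  · rw [← cancel_epi φ, reassoc_of% hm]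
    simp [φ, f.comm_c, reassoc_of% S.m_c]
  · rw [← cancel_epi f.f₁, hmul _ _ ((𝟙 G.X₁ ≫ G.d) ≫ G.e) (𝟙 _) (by simp)
      (by simp [f.comm_e, f.comm_d_assoc]) (by simp), S.id_mul]
    simp
  · rw [← cancel_epi f.f₁, hmul _ _ (𝟙 _) ((𝟙 G.X₁ ≫ G.c) ≫ G.e) (by simp)
      (by simp) (by simp [f.comm_e, f.comm_c_assoc]), S.mul_id]
    simp
  -- Associativity is checked on the universal triple of `H`, lifted locally to a composable triple
  -- of `G`.
  · obtain ⟨T, p, hp, a, b, c, hab, hbc, ha, hb, hc⟩ := S.exists_local_lift_triple hC f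
      (pullback.fst (pullback.snd H.c H.d) (pullback.fst H.c H.d) ≫ pullback.fst H.c H.d)
      (pullback.fst (pullback.snd H.c H.d) (pullback.fst H.c H.d) ≫ pullback.snd H.c H.d)
      (pullback.snd (pullback.snd H.c H.d) (pullback.fst H.c H.d) ≫ pullback.snd H.c H.d)
      (by simp [pullback.condition (f := H.c)])
      (by rw [pullback.condition]; simp [pullback.condition (f := H.c)])
    have epi' : Epi p := inferInstance
    rw [← cancel_epi p,
      hmul p _ a (S.mul b c hbc) (by simpa using hab) (by rw [pullback.lift_fst, ha])
        (by
          rw [pullback.lift_snd, hmul p _ b c hbc _ hc.symm]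
          rw [hb, pullback.condition]),
      hmul p _ (S.mul a b hab) c (by simpa using hbc)
        (by rw [pullback.lift_fst, hmul p _ a b hab ha.symm hb.symm])
        (by rw [pullback.lift_snd, hc]), S.mul_assoc]
  · rw [← cancel_epi f.f₁, reassoc_of% hi, f.comm_d, f.comm_c, S.i_d_assoc]
  · rw [← cancel_epi f.f₁, reassoc_of% hi, f.comm_d, f.comm_c, S.i_c_assoc]
  · have h := S.isInverse (𝟙 G.X₁)
    rw [← cancel_epi f.f₁, hmul _ _ (𝟙 _ ≫ S.i) (𝟙 _) h.hd (by simp [hi]) (by simp), h.inv_mul]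
    simp [f.comm_e, f.comm_c_assoc]
  · have h := S.isInverse (𝟙 G.X₁)
    rw [← cancel_epi f.f₁, hmul _ _ (𝟙 _) (𝟙 _ ≫ S.i) h.hc (by simp) (by simp [hi]), h.mul_inv]
    simp [f.comm_e, f.comm_d_assoc]

end

/-! ### From closure under quotients to 3-permutability -/

section

variable {C : Type u} [Category.{v} C]

/-- An equivalence relation, seen as a reflexive graph, is an internal groupoid. -/
lemma nonempty_internalGroupoid_of_relation [HasPullbacks C] {G : ReflexiveGraph C}
    (ext : ∀ ⦃T : C⦄ (a b : T ⟶ G.X₁), a ≫ G.d = b ≫ G.d → a ≫ G.c = b ≫ G.c → a = b)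
    (symm : ∀ ⦃T : C⦄ (a : T ⟶ G.X₁), ∃ b : T ⟶ G.X₁, b ≫ G.d = a ≫ G.c ∧ b ≫ G.c = a ≫ G.d)
    (trans : ∀ ⦃T : C⦄ (a b : T ⟶ G.X₁), a ≫ G.c = b ≫ G.d →
      ∃ c : T ⟶ G.X₁, c ≫ G.d = a ≫ G.d ∧ c ≫ G.c = b ≫ G.c) :
    Nonempty (InternalGroupoid G) := by
  obtain ⟨m, m_d, m_c⟩ := trans (pullback.fst G.c G.d) (pullback.snd G.c G.d) pullback.condition
  obtain ⟨i, i_d, i_c⟩ := symm (𝟙 G.X₁)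
  rw [Category.id_comp] at i_d i_c
  exact ⟨{
    m := m
    m_d := m_d
    m_c := m_c
    id_m := ext _ _ (by simp [m_d]) (by simp [m_c])
    m_id := ext _ _ (by simp [m_d]) (by simp [m_c])
    assoc := ext _ _ (by simp [m_d]) (by simp [m_c])
    i := i
    i_d := i_d
    i_c := i_c
    i_m := ext _ _ (by simp [m_d, i_d]) (by simp [m_c])
    m_i := ext _ _ (by simp [m_d]) (by simp [m_c, i_c]) }⟩

end

section

variable {C : Type u} [Category.{v} C] [Regular C]

namespace Relation

variable {X : C} {R S : Relation X X}

/-- The inverse image of a relation along a morphism, with its two legs paired. -/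
abbrev inverseImage {Y : C} (S : Relation X X) (r : Y ⟶ X) : C :=
  pullback S.arrow (prod.map r r)

lemma exists_inverseImage {Y T : C} (r : Y ⟶ X) {y z : T ⟶ Y} (h : S.Rel (y ≫ r) (z ≫ r)) :
    ∃ w : T ⟶ inverseImage S r,
      w ≫ pullback.snd _ _ ≫ prod.fst = y ∧ w ≫ pullback.snd _ _ ≫ prod.snd = z := by
  obtain ⟨w, h₁, h₂⟩ := h
  exact ⟨pullback.lift w (prod.lift y z) (by ext <;> simpa), by simp, by simp⟩

lemma inverseImage_hom_ext {Y T : C} (r : Y ⟶ X) {a b : T ⟶ inverseImage S r}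
    (h₁ : a ≫ pullback.snd _ _ ≫ prod.fst = b ≫ pullback.snd _ _ ≫ prod.fst)
    (h₂ : a ≫ pullback.snd _ _ ≫ prod.snd = b ≫ pullback.snd _ _ ≫ prod.snd) : a = b := by
  rw [← cancel_mono (pullback.snd S.arrow (prod.map r r))]
  ext <;> simpa

lemma rel_inverseImage {Y T : C} (r : Y ⟶ X) (a : T ⟶ inverseImage S r) :
    S.Rel (a ≫ (pullback.snd _ _ ≫ prod.fst) ≫ r) (a ≫ (pullback.snd _ _ ≫ prod.snd) ≫ r) := by
  have h₁ := congr(a ≫ $(pullback.condition (f := S.arrow) (g := prod.map r r)) ≫ prod.fst)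
  have h₂ := congr(a ≫ $(pullback.condition (f := S.arrow) (g := prod.map r r)) ≫ prod.snd)
  exact ⟨a ≫ pullback.fst _ _, by simpa using h₁, by simpa using h₂⟩

/-- The direct image along `q` of the inverse image along `r` of a relation. -/
def transport {Y : C} (S : Relation X X) (r q : Y ⟶ X) : Relation X X :=
  imageSubobject (prod.lift ((pullback.snd S.arrow (prod.map r r) ≫ prod.fst) ≫ q)
    ((pullback.snd S.arrow (prod.map r r) ≫ prod.snd) ≫ q))

/-- When `r` and `q` are the left and right legs of a relation `R`, this presents the transport as
`R S R°`, hence as `RSR` for symmetric `R`. -/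
lemma rel_transport_iff {Y T : C} (r q : Y ⟶ X) {x y : T ⟶ X} :
    (transport S r q).Rel x y ↔ ∃ (T' : C) (p : T' ⟶ T) (_ : IsRegularEpi p) (a b : T' ⟶ Y),
      a ≫ q = p ≫ x ∧ b ≫ q = p ≫ y ∧ S.Rel (a ≫ r) (b ≫ r) := by
  rw [transport, rel_image_iff]
  constructor
  · rintro ⟨T', p, hp, w, hw⟩
    have h₁ := congr($hw ≫ prod.fst)
    have h₂ := congr($hw ≫ prod.snd)
    simp only [Category.assoc, prod.lift_fst, prod.lift_snd] at h₁ h₂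
    exact ⟨T', p, hp, w ≫ pullback.snd _ _ ≫ prod.fst, w ≫ pullback.snd _ _ ≫ prod.snd,
      by simpa using h₁, by simpa using h₂, by simpa using rel_inverseImage r w⟩
  · rintro ⟨T', p, hp, a, b, ha, hb, h⟩
    obtain ⟨w, rfl, rfl⟩ := exists_inverseImage r h
    exact ⟨T', p, hp, w, by ext; exacts [by simpa using ha, by simpa using hb]⟩

/-- If the quotients of internal groupoids are internal categories, then the image along a split
epimorphism of the inverse image of an equivalence relation is transitive. -/
lemma transport_trans (h : ∀ ⦃A B : ReflexiveGraph C⦄ (f : A ⟶ B), IsRegularEpi f →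
      isGrpd C A → isCat C B)
    {Y : C} (hS : S.IsEquiv) (r q : Y ⟶ X) (s : X ⟶ Y) (hs : s ≫ q = 𝟙 X) {T : C} {x y z : T ⟶ X}
    (hxy : (transport S r q).Rel x y) (hyz : (transport S r q).Rel y z) :
    (transport S r q).Rel x z := by
  obtain ⟨e, he₁, he₂⟩ := exists_inverseImage r (y := 𝟙 Y) (z := 𝟙 Y) (hS.refl _)
  let A : ReflexiveGraph C :=
    { X₀ := Y
      X₁ := inverseImage S r
      d := pullback.snd _ _ ≫ prod.fst
      c := pullback.snd _ _ ≫ prod.snd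
      e := e
      e_d := he₁
      e_c := he₂ }
  have hA : Nonempty (InternalGroupoid A) := nonempty_internalGroupoid_of_relation
    (fun T a b => inverseImage_hom_ext r)
    (fun T a => exists_inverseImage r (by simpa [A] using hS.symm (rel_inverseImage r a)))
    (fun T a b hab => exists_inverseImage r (by
      have h₁ := rel_inverseImage r a
      have h₂ := rel_inverseImage r b
      have hab' : a ≫ (pullback.snd _ _ ≫ prod.snd) ≫ r = b ≫ (pullback.snd _ _ ≫ prod.fst) ≫ r :=
        by simpa [A] using congr($hab ≫ r)
      rw [hab'] at h₁
      simpa [A] using hS.trans h₁ h₂))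
  let N : Relation X X := transport S r q
  let g : A.X₁ ⟶ (N : C) := factorThruImageSubobject _
  have hg : g ≫ N.arrow = prod.lift (A.d ≫ q) (A.c ≫ q) := imageSubobject_arrow_comp _
  have hg_epi : IsRegularEpi g := isRegularEpi_comp (factorThruImage _) (imageSubobjectIso _).inv
  -- The image relation is reflexive because `q` has a section; since its legs are jointly monic,
  -- preservation of units by `f` does not depend on the choice of section.
  let B : ReflexiveGraph C :=
    { X₀ := X
      X₁ := N
      d := Relation.left N
      c := Relation.right N
      e := s ≫ A.e ≫ g
      e_d := by simp [reassoc_of% hg, hs]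
      e_c := by simp [reassoc_of% hg, hs] }
  let f : A ⟶ B := ReflexiveGraph.Hom.mk q g (by simp [B, reassoc_of% hg])
    (by simp [B, reassoc_of% hg])
    (Relation.hom_ext N (by simp [B, reassoc_of% hg, hs]) (by simp [B, reassoc_of% hg, hs]))
  have : IsSplitEpi q := ⟨⟨⟨s, hs⟩⟩⟩
  have hq : IsRegularEpi f.f₀ := inferInstanceAs (IsRegularEpi q)
  have hg' : IsRegularEpi f.f₁ := hg_epi
  -- The category structure on the quotient composes related pairs, which is transitivity.
  obtain ⟨M⟩ := h f (ReflexiveGraph.isRegularEpi_of_levelwise f) hA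
  obtain ⟨w, rfl, hw⟩ := hxy
  obtain ⟨w', hw', rfl⟩ := hyz
  exact ⟨M.mul (G := B) w w' (hw.trans hw'.symm), M.mul_d _ _ _, M.mul_c _ _ _⟩

/-- `RSR` is the transport of `S` along the legs of `R`, hence transitive, and by reflexivity it
contains `R` and `S`; so it contains `SRS`. -/
lemma comp_comp_le (h : ∀ ⦃A B : ReflexiveGraph C⦄ (f : A ⟶ B), IsRegularEpi f →
      isGrpd C A → isCat C B) (hR : R.IsEquiv) (hS : S.IsEquiv) :
    Relation.comp (Relation.comp S R) S ≤ Relation.comp (Relation.comp R S) R := by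
  refine le_of_rel ?_
  obtain ⟨T, p, hp, y, z, hxy, hyz, hzw⟩ := exists_of_rel_comp_comp
    (rel_left_right (Relation.comp (Relation.comp S R) S))
  obtain ⟨s, hs₁, hs₂⟩ := hR.refl (𝟙 X)
  have rel {T : C} {x y x' y' : T ⟶ X} (h₁ : R.Rel x x') (h₂ : S.Rel x' y') (h₃ : R.Rel y' y) :
      (transport S (Relation.left R) (Relation.right R)).Rel x y := by
    obtain ⟨a, rfl, rfl⟩ := hR.symm h₁
    obtain ⟨b, rfl, rfl⟩ := h₃
    exact (rel_transport_iff _ _).2 ⟨_, 𝟙 _, inferInstance, a, b, by simp, by simp, h₂⟩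
  -- The three links of the `SRS` chain lie in `RSR`, each padded by reflexivity, and two uses of
  -- transitivity join them.
  have key := transport_trans h hS _ _ s hs₂
    (transport_trans h hS _ _ s hs₂ (rel (hR.refl _) hxy (hR.refl _))
      (rel (hR.refl _) (hS.refl _) hyz)) (rel (hR.refl _) hzw (hR.refl _))
  obtain ⟨T', q, hq, a, b, ha, hb, hab⟩ := (rel_transport_iff _ _).1 key
  have hqp := isRegularEpi_comp q p
  refine rel_of_local (q ≫ p) (rel_comp_comp (hR.symm ⟨a, rfl, ?_⟩) hab ⟨b, rfl, ?_⟩)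
  · rw [ha, Category.assoc]
  · rw [hb, Category.assoc]

end Relation

/-- A regular category in which the quotients of internal groupoids are internal categories is a
Goursat category. -/
lemma isGoursat_of_quotient (h : ∀ ⦃A B : ReflexiveGraph C⦄ (f : A ⟶ B), IsRegularEpi f →
    isGrpd C A → isCat C B) : IsGoursat C := fun _ _ _ hR hS =>
  le_antisymm (Relation.comp_comp_le h hS hR) (Relation.comp_comp_le h hR hS)

lemma isCat_of_isGrpd {G : ReflexiveGraph C} (h : isGrpd C G) : isCat C G :=
  h.map InternalGroupoid.toInternalCategory

end

end Goursat

end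

theorem mainTheorem2 (C : Type u) [Category.{v} C] [Regular C] :
    [Goursat.IsGoursat C,
      Goursat.ClosedUnderRegularQuotients (Goursat.isGrpd C),
      Goursat.ClosedUnderRegularQuotients (Goursat.isCat C)].TFAE := by
  have quotient (hC : Goursat.IsGoursat C) {A B : Goursat.ReflexiveGraph C} (f : A ⟶ B)
      (hf : IsRegularEpi f) (hA : Goursat.isGrpd C A) : Goursat.isGrpd C B := by
    obtain ⟨S⟩ := hA
    obtain ⟨h₀, h₁⟩ := Goursat.ReflexiveGraph.levelwise_of_isRegularEpi f
    exact Goursat.nonempty_internalGroupoid_of_quotient hC S f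
  tfae_have 1 → 2 := fun hC _ _ f hf hA => quotient hC f hf hA
  tfae_have 1 → 3 := fun hC _ _ f hf hA => Goursat.isCat_of_isGrpd <| quotient hC f hf <| by
    obtain ⟨S⟩ := hA
    exact S.nonempty_internalGroupoid hC
  tfae_have 2 → 1 := fun h => Goursat.isGoursat_of_quotient fun _ _ f hf hA =>
    Goursat.isCat_of_isGrpd (h f hf hA)
  tfae_have 3 → 1 := fun h => Goursat.isGoursat_of_quotient fun _ _ f hf hA =>
    h f hf (Goursat.isCat_of_isGrpd hA)
  tfae_finish
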